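/- Let $n\ge 1$. Let $B_n$ be the braid group on $n$ strands with Artin generators $b_1,\dots,b_{n-1}$, let $PB_n$ be the kernel of the standard surjection $B_n\to S_n$ sending $b_i$ to the transposition $(i\ i{+}1)$, let $PB_n^2$ be the subgroup generated by the squares of all elements of $PB_n$, and put $\mathcal Z_n=B_n/PB_n^2$ (the mod 4 braid group) and $G_n=B_n/[PB_n,PB_n]$. For $i<j$ put $b_{i,j}=b_i\cdots b_{j-2}\,b_{j-1}\,b_{j-2}^{-1}\cdots b_i^{-1}$. For $R=\mathbb Z$ or $R=\mathbb Z_2=\mathbb Z/2\mathbb Z$ let $R^{\binom n2}$ be the free $R$-module on the unordered pairs of distinct elements of $\{1,\dots,n\}$, with $S_n$ permuting the pairs. Then $B_n\to S_n$ makes $G_n$ and $\mathcal Z_n$ into extensions $$0\to\mathbb Z^{\binom n2}\to G_n\to S_n\to 1,\qquad 0\to\mathbb Z_2^{\binom n2}\to \mathcal Z_n\to S_n\to 1,$$ in which the basis element $\{i,j\}$ is sent to the class of $b_{i,j}^2$ and conjugation induces the given action of $S_n$; the first inclusion identifies $\mathbb Z^{\binom n2}$ with $H_1(PB_n;\mathbb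 Z)=PB_n/[PB_n,PB_n]\subseteq G_n$. Let $[\phi]\in H^2(S_n;\mathbb Z^{\binom n2})$ and $[\kappa]\in H^2(S_n;\mathbb Z_2^{\binom n2})$ be the cohomology classes that classify these two extensions. Then $[\kappa]$ is the mod 2 reduction of $[\phi]$, and if $n\ge 2$, then $[\phi]$ has order $2$. (For $n=1$ both cohomology groups are zero.) -/

import Mathlib

open groupCohomology

noncomputable section

namespace BraidExt

/-! ### The braid group, the pure braid group and the two quotients -/

/-- The relators of the Artin presentation. The generator with index `i : Fin (n - 1)` (counted
from `0`) is the half twist of the neighbouring strands `i` and `i + 1`, with strands labelled by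
`Fin n`. -/
def braidRels (n : ℕ) : Set (FreeGroup (Fin (n - 1))) :=
  {r | ∃ i j : Fin (n - 1), (i : ℕ) + 1 = j ∧
      r = FreeGroup.of i * FreeGroup.of j * FreeGroup.of i *
        (FreeGroup.of j * FreeGroup.of i * FreeGroup.of j)⁻¹} ∪
  {r | ∃ i j : Fin (n - 1), (i : ℕ) + 1 < j ∧
      r = FreeGroup.of i * FreeGroup.of j * (FreeGroup.of j * FreeGroup.of i)⁻¹}

/-- The braid group on `n` strands, by the Artin presentation. -/
abbrev Braid (n : ℕ) : Type := PresentedGroup (braidRels n)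

/-- The transposition of the neighbouring points `i` and `i + 1`. -/
def adjSwap (n : ℕ) (i : Fin (n - 1)) : Equiv.Perm (Fin n) :=
  Equiv.swap ⟨i, by omega⟩ ⟨i + 1, by omega⟩

theorem adjSwap_rels (n : ℕ) : ∀ r ∈ braidRels n, FreeGroup.lift (adjSwap n) r = 1 := by
  rintro r (⟨i, j, hij, rfl⟩ | ⟨i, j, hij, rfl⟩)
  · simp only [map_mul, map_inv, FreeGroup.lift_apply_of, mul_inv_eq_one]
    have hj : adjSwap n j = Equiv.swap ⟨i + 1, by omega⟩ ⟨i + 2, by omega⟩ := by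
      simp only [adjSwap, ← hij]
    have key : ∀ a b c : Fin n, a ≠ b → b ≠ c → a ≠ c →
        Equiv.swap a b * Equiv.swap b c * Equiv.swap a b =
          Equiv.swap b c * Equiv.swap a b * Equiv.swap b c := fun a b c hab hbc hac => by
      rw [Equiv.swap_mul_swap_mul_swap hab hac, Equiv.swap_comm a b, Equiv.swap_comm b c,
        Equiv.swap_mul_swap_mul_swap hbc.symm hac.symm, Equiv.swap_comm]
    rw [hj, adjSwap]
    exact key _ _ _ (by simp) (by simp) (by simp)
  · simp only [map_mul, map_inv, FreeGroup.lift_apply_of, mul_inv_eq_one]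
    rw [adjSwap, adjSwap, Equiv.mul_swap_eq_swap_mul, Equiv.swap_apply_of_ne_of_ne,
      Equiv.swap_apply_of_ne_of_ne] <;> simp [Fin.ext_iff] <;> omega

/-- The standard surjection `B_n → S_n`. -/
def braidPerm (n : ℕ) : Braid n →* Equiv.Perm (Fin n) :=
  PresentedGroup.toGroup (adjSwap_rels n)

/-- The pure braid group `PB_n`. -/
abbrev PureBraid (n : ℕ) : Subgroup (Braid n) := (braidPerm n).ker

/-- `PB_n²`, the subgroup generated by the squares of all pure braids. -/
def pureSquares (n : ℕ) : Subgroup (Braid n) :=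
  Subgroup.closure {x | ∃ p ∈ PureBraid n, x = p ^ 2}

instance (n : ℕ) : (pureSquares n).Normal := by
  apply Subgroup.Normal.mk
  intro x hx g
  induction hx using Subgroup.closure_induction with
  | mem x hx =>
    obtain ⟨p, hp, rfl⟩ := hx
    exact Subgroup.subset_closure
      ⟨g * p * g⁻¹, (inferInstance : (PureBraid n).Normal).conj_mem p hp g, by simp [conj_pow]⟩
  | one => simp
  | mul x y _ _ hx hy =>
    have h : g * (x * y) * g⁻¹ = (g * x * g⁻¹) * (g * y * g⁻¹) := by group
    rw [h]
    exact mul_mem hx hy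
  | inv x _ hx =>
    have h : g * x⁻¹ * g⁻¹ = (g * x * g⁻¹)⁻¹ := by group
    rw [h]
    exact inv_mem hx

/-- The mod 4 braid group `Z_n = B_n / PB_n²`. -/
abbrev ModFourBraid (n : ℕ) : Type := Braid n ⧸ pureSquares n

/-- `G_n = B_n / [PB_n, PB_n]`. -/
abbrev BraidModComm (n : ℕ) : Type := Braid n ⧸ ⁅PureBraid n, PureBraid n⁆

/-- The Artin generator `b_i` (with the value `1` for indices that are out of range). -/
def gen (n i : ℕ) : Braid n := if h : i < n - 1 then PresentedGroup.of ⟨i, h⟩ else 1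

/-- The word `b_i b_{i+1} ⋯ b_{j-2}`. -/
def conjWord (n i j : ℕ) : Braid n := ((List.range' i (j - 1 - i)).map (gen n)).prod

/-- For `i < j`, the half twist of the strands `i` and `j`:
`b_{i,j} = b_i ⋯ b_{j-2} b_{j-1} b_{j-2}⁻¹ ⋯ b_i⁻¹`. -/
def halfTwist (n : ℕ) (i j : Fin n) : Braid n :=
  conjWord n i j * gen n ((j : ℕ) - 1) * (conjWord n i j)⁻¹

/-! ### The permutation modules on unordered pairs -/

/-- Unordered pairs of distinct elements of an `n`-element set. -/
abbrev UPair (n : ℕ) : Type := {p : Sym2 (Fin n) // ¬ p.IsDiag}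

/-- The pair `{i, j}`, for `i < j`. -/
def mkPair {n : ℕ} {i j : Fin n} (h : i < j) : UPair n :=
  ⟨s(i, j), by simpa using h.ne⟩

/-- `S_n` permutes unordered pairs: `g • {i, j} = {g i, g j}`. -/
instance (n : ℕ) : MulAction (Equiv.Perm (Fin n)) (UPair n) where
  smul g p := ⟨p.1.map g, by rw [Sym2.isDiag_map g.injective]; exact p.2⟩
  one_smul p := Subtype.ext (by
    change p.1.map (id : Fin n → Fin n) = p.1
    rw [Sym2.map_id]; rfl)
  mul_smul g h p := Subtype.ext (by
    change p.1.map (g ∘ h) = (p.1.map h).map g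
    rw [Sym2.map_map])

/-- The permutation of the basis of `R^{C(n,2)}` as a representation of `S_n` over `ℤ`. -/
def pairRho (R : Type) [CommRing R] (n : ℕ) :
    Representation ℤ (Equiv.Perm (Fin n)) (UPair n →₀ R) where
  toFun g := Finsupp.lmapDomain R ℤ (g • ·)
  map_one' := by ext; simp
  map_mul' g h := by ext; simp [mul_smul]

/-- The `S_n`-module `R^{C(n,2)}`: the free `R`-module on the unordered pairs of distinct elements
of `{1, …, n}`, with `S_n` permuting the pairs. -/
abbrev pairRep (R : Type) [CommRing R] (n : ℕ) : Rep ℤ (Equiv.Perm (Fin n)) :=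
  Rep.of (pairRho R n)

/-- Coefficientwise reduction `ℤ^{C(n,2)} → (ℤ/2)^{C(n,2)}`, as a map of `S_n`-modules. -/
def reduceModTwo (n : ℕ) : pairRep ℤ n ⟶ pairRep (ZMod 2) n :=
  Rep.ofHom (LinearMap.intertwiningMap_of_isIntertwiningMap (pairRho ℤ n) (pairRho (ZMod 2) n)
    (Finsupp.mapRange.linearMap (Int.castAddHom (ZMod 2)).toIntLinearMap)
    (fun g v => (Finsupp.mapDomain_mapRange (g • ·) v (Int.castAddHom (ZMod 2)) (map_zero _)
      (map_add _)).symm))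

/-! ### Extensions and the classes that classify them -/

/-- The extension `0 → A → E → Q → 1` gives rise to the `Q`-module structure of `A`: conjugation
by `x : E` acts on `A` as the image of `x` in `Q` does. -/
def GivesRise {Q E : Type} [Group Q] [Group E] (A : Rep ℤ Q)
    (S : GroupExtension (Multiplicative A) E Q) : Prop :=
  ∀ (x : E) (a : A), x * S.inl (Multiplicative.ofAdd a) * x⁻¹ =
    S.inl (Multiplicative.ofAdd (A.ρ (S.rightHom x) a))

/-- The extension `0 → A → E → Q → 1` gives rise to the module `A`, and `c ∈ H²(Q; A)` is its
class: for every set-theoretic section `s`, the factor set `f` determined by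
`s(p) s(q) = f(p, q) s(p q)` is a `2`-cocycle that represents `c`. -/
def IsClassifiedBy {Q E : Type} [Group Q] [Group E] (A : Rep ℤ Q)
    (S : GroupExtension (Multiplicative A) E Q) (c : H2 A) : Prop :=
  GivesRise A S ∧ ∀ s : S.Section, ∃ f : cocycles₂ A,
    (∀ p q : Q, s p * s q = S.inl (Multiplicative.ofAdd (f (p, q))) * s (p * q)) ∧ H2π A f = c

/-- `S` is the standard extension structure on a quotient `B_n / N`: the map to `S_n` is induced by
`B_n → S_n`, and the basis element `{i, j}` of `R^{C(n,2)}` goes to the class of the full twist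
`b_{i,j}²`. These two conditions determine `S` when `R` is `ℤ` or `ℤ/2`. -/
def IsStandard {R : Type} [CommRing R] {n : ℕ} {N : Subgroup (Braid n)} [N.Normal]
    (S : GroupExtension (Multiplicative (pairRep R n)) (Braid n ⧸ N) (Equiv.Perm (Fin n))) : Prop :=
  (∀ b : Braid n, S.rightHom (QuotientGroup.mk b) = braidPerm n b) ∧
  ∀ (i j : Fin n) (h : i < j),
    S.inl (Multiplicative.ofAdd (Finsupp.single (mkPair h) (1 : R) : UPair n →₀ R)) =
      QuotientGroup.mk (halfTwist n i j ^ 2)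

end BraidExt

end

open groupCohomology

noncomputable section

namespace BraidExt

/-! ### Factor sets -/

section FactorSets

variable {Q E : Type} [Group Q] [Group E] {A : Rep ℤ Q}
  {S : GroupExtension (Multiplicative A) E Q}

/-! Everything rests on counting signed crossings. Sending `b_i` to (`{i, i+1}`, `(i i+1)`) respects
the Artin relations and gives `winding : B_n → ℤ^{C(n,2)} ⋊ S_n`. It maps the full twist of a pair
to twice that pair and kills `[PB_n, PB_n]`, so the composite `ℤ^{C(n,2)} → G_n → ℤ^{C(n,2)} ⋊ S_n`
is multiplication by 2 (`windingOfModComm_twistInl`).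

This composite shows that the classes of the full twists are independent in `G_n`. Conjugation
permutes these classes (`mk_conj_fullTwist`). Modulo them, the generators become involutions
satisfying the braid relations, so the Coxeter presentation makes the quotient embed in `S_n`; hence
the full twists span `PB_n / [PB_n, PB_n]` (`ker_permOfModComm_le`). Inside this group the image of
`PB_n²` is the set of doubles, so the extension `Z_n` is the pushout of `G_n` along reduction modulo
2, and its factor set is the reduced one.

The same composite gives `2[φ] = 0`: after multiplication by 2 the extension maps to a split one. On
the other hand `[φ] ≠ 0` for `n ≥ 2`: a lift of the transposition of the first two points is `a
b_1`, and its square has the odd coefficient `2a_{12} + 1` at the pair `{1, 2}`, so no lift is an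
involution. -/

theorem GivesRise.mul_inl (hS : GivesRise A S) (x : E) (a : A) :
    x * S.inl (Multiplicative.ofAdd a) =
      S.inl (Multiplicative.ofAdd (A.ρ (S.rightHom x) a)) * x := by
  rw [← hS, inv_mul_cancel_right]

theorem inl_ofAdd_mul_cancel {a b : A} {x : E}
    (h : S.inl (Multiplicative.ofAdd a) * x = S.inl (Multiplicative.ofAdd b) * x) : a = b :=
  Multiplicative.ofAdd.injective (S.inl_injective (mul_right_cancel h))

theorem exists_eq_inl_ofAdd_mul {x y : E} (h : S.rightHom x = S.rightHom y) :
    ∃ a : A, x = S.inl (Multiplicative.ofAdd a) * y := by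
  have hmem : x * y⁻¹ ∈ S.inl.range := by
    rw [S.range_inl_eq_ker_rightHom, MonoidHom.mem_ker, map_mul, map_inv, h, mul_inv_cancel]
  obtain ⟨a, ha⟩ := hmem
  exact ⟨a.toAdd, by rw [ofAdd_toAdd, ha, inv_mul_cancel_right]⟩

/-- Multiplication of elements of the form `inl a * x`. -/
theorem GivesRise.inl_mul_mul_inl_mul (hS : GivesRise A S) (a b : A) (x y : E) :
    S.inl (Multiplicative.ofAdd a) * x * (S.inl (Multiplicative.ofAdd b) * y) =
      S.inl (Multiplicative.ofAdd (a + A.ρ (S.rightHom x) b)) * (x * y) := by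
  rw [mul_assoc, ← mul_assoc x, hS.mul_inl, ofAdd_add, map_mul]
  simp only [mul_assoc]

theorem inl_mul_inl_mul (a b : A) (x : E) :
    S.inl (Multiplicative.ofAdd a) * (S.inl (Multiplicative.ofAdd b) * x) =
      S.inl (Multiplicative.ofAdd (a + b)) * x := by
  rw [ofAdd_add, map_mul, mul_assoc]

/-- The cocycle identity is associativity of `s p * s q * s r`, with the common factor `s (p * q *
r)` cancelled. -/
theorem GivesRise.exists_factorSet (hS : GivesRise A S) (s : S.Section) :
    ∃ f : cocycles₂ A, ∀ p q : Q,
      s p * s q = S.inl (Multiplicative.ofAdd (f (p, q))) * s (p * q) := by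
  have h : ∀ pq : Q × Q, ∃ a : A,
      s pq.1 * s pq.2 = S.inl (Multiplicative.ofAdd a) * s (pq.1 * pq.2) := fun pq =>
    exists_eq_inl_ofAdd_mul (by simp)
  choose f hf using h
  refine ⟨⟨f, (mem_cocycles₂_iff f).2 fun p q r => ?_⟩, fun p q => hf (p, q)⟩
  apply inl_ofAdd_mul_cancel (S := S) (x := s (p * q * r))
  have h₁ := hf (p, q)
  have h₂ := hf (p * q, r)
  have h₃ := hf (q, r)
  have h₄ := hf (p, q * r)
  dsimp only at h₁ h₂ h₃ h₄
  rw [← mul_assoc p] at h₄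
  calc _ = s p * s q * s r := by
          rw [h₁, mul_assoc _ (s (p * q)), h₂, inl_mul_inl_mul, add_comm]
    _ = _ := by
          rw [mul_assoc, h₃, ← mul_assoc, hS.mul_inl, mul_assoc, h₄, inl_mul_inl_mul,
            GroupExtension.Section.rightHom_section]

/-- Two sections differ by a 1-cochain `h`, and their factor sets then differ by its coboundary, so
the class can be computed from any one section. -/
theorem GivesRise.isClassifiedBy (hS : GivesRise A S) (s : S.Section) (f : cocycles₂ A)
    (hf : ∀ p q : Q, s p * s q = S.inl (Multiplicative.ofAdd (f (p, q))) * s (p * q)) :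
    IsClassifiedBy A S (H2π A f) := by
  refine ⟨hS, fun s' => ?_⟩
  obtain ⟨f', hf'⟩ := hS.exists_factorSet s'
  refine ⟨f', hf', ?_⟩
  have h : ∀ p : Q, ∃ a : A, s' p = S.inl (Multiplicative.ofAdd a) * s p := fun p =>
    exists_eq_inl_ofAdd_mul (by simp)
  choose h hh using h
  rw [H2π_eq_iff]
  refine ⟨h, funext fun ⟨p, q⟩ => ?_⟩
  have key : f' (p, q) + h (p * q) = h p + A.ρ p (h q) + f (p, q) := by
    apply inl_ofAdd_mul_cancel (S := S) (x := s (p * q))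
    rw [← inl_mul_inl_mul, ← hh, ← hf', hh p, hh q, hS.inl_mul_mul_inl_mul, hf, inl_mul_inl_mul,
      GroupExtension.Section.rightHom_section]
  have key' : f' (p, q) = h p + A.ρ p (h q) + f (p, q) - h (p * q) := eq_sub_of_add_eq key
  rw [d₁₂_hom_apply]
  change _ = f' (p, q) - f (p, q)
  rw [key']
  dsimp only
  abel

end FactorSets

/-! ### Braid relations and half twists in an arbitrary group -/

section Words

variable {H : Type*} [Group H]

/-- The elements `t 0, …, t (m - 1)` satisfy the braid relations. -/
structure BraidRelations (t : ℕ → H) (m : ℕ) : Prop where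
  braid : ∀ i, i + 1 < m → t i * t (i + 1) * t i = t (i + 1) * t i * t (i + 1)
  comm : ∀ i j, i + 1 < j → j < m → Commute (t i) (t j)

/-- The product `t i * t (i + 1) * ⋯ * t (i + l - 1)`. -/
def word (t : ℕ → H) (i l : ℕ) : H := ((List.range' i l).map t).prod

@[simp] theorem word_zero (t : ℕ → H) (i : ℕ) : word t i 0 = 1 := by simp [word]

theorem word_succ (t : ℕ → H) (i l : ℕ) : word t i (l + 1) = t i * word t (i + 1) l := by
  simp [word, List.range'_succ]

theorem word_succ' (t : ℕ → H) (i l : ℕ) : word t i (l + 1) = word t i l * t (i + l) := by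
  simp [word, List.range'_concat]

theorem BraidRelations.mono {t : ℕ → H} {m m' : ℕ} (h : BraidRelations t m) (hm : m' ≤ m) :
    BraidRelations t m' :=
  ⟨fun i hi => h.braid i (hi.trans_le hm), fun i j hij hj => h.comm i j hij (hj.trans_le hm)⟩

theorem BraidRelations.comm' {t : ℕ → H} {m i j : ℕ} (h : BraidRelations t m)
    (hij : i + 1 < j ∨ j + 1 < i) (hi : i < m) (hj : j < m) : Commute (t i) (t j) := by
  rcases hij with hij | hij
  · exact h.comm i j hij hj
  · exact (h.comm j i hij hi).symm

theorem commute_word {t : ℕ → H} {x : H} {i l : ℕ}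
    (h : ∀ k, i ≤ k → k < i + l → Commute x (t k)) : Commute x (word t i l) := by
  refine Commute.list_prod_right _ _ fun y hy => ?_
  obtain ⟨k, hk, rfl⟩ := List.mem_map.1 hy
  rw [List.mem_range'_1] at hk
  exact h k hk.1 hk.2

theorem BraidRelations.commute_word {t : ℕ → H} {m : ℕ} (h : BraidRelations t m) {k i l : ℕ}
    (hk : k < m) (hil : i + l ≤ m) (hki : k + 1 < i ∨ i + l < k) :
    Commute (t k) (word t i l) := by
  rcases Nat.eq_zero_or_pos l with rfl | hl
  · simp
  refine BraidExt.commute_word fun j hij hj => ?_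
  exact h.comm' (by omega) hk (by omega)

/-- A generator moves through an ascending word, with its index lowered by one. -/
theorem BraidRelations.mul_word {t : ℕ → H} {m : ℕ} (h : BraidRelations t m) {k i l : ℕ}
    (hil : i + l ≤ m) (hik : i ≤ k) (hk : k + 1 < i + l) :
    t (k + 1) * word t i l = word t i l * t k := by
  induction l generalizing i with
  | zero => omega
  | succ l ih =>
    -- Letters before `t k` commute with `t (k + 1)`. At `t k` one braid relation suffices, since
    -- the tail after `t (k + 1)` commutes with `t k`.
    rcases hik.eq_or_lt with rfl | hik
    · obtain ⟨l, rfl⟩ : ∃ l', l = l' + 1 := ⟨l - 1, by omega⟩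
      have hc : Commute (t i) (word t (i + 1 + 1) l) :=
        h.commute_word (by omega) (by omega) (by omega)
      simp only [word_succ, mul_assoc]
      rw [← hc.eq]
      simp only [← mul_assoc]
      rw [h.braid i (by omega)]
    · rw [word_succ, ← mul_assoc, ← (h.comm i (k + 1) (by omega) (by omega)).eq, mul_assoc,
        ih (by omega) (by omega) (by omega), mul_assoc]

/-- The half twist `t i ⋯ t (j - 2) t (j - 1) t (j - 2)⁻¹ ⋯ t i⁻¹`. -/
def halfWord (t : ℕ → H) (i j : ℕ) : H :=
  word t i (j - 1 - i) * t (j - 1) * (word t i (j - 1 - i))⁻¹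

theorem halfWord_self_succ (t : ℕ → H) (i : ℕ) : halfWord t i (i + 1) = t i := by
  simp [halfWord]

/-- Replaces the truncated subtractions of `halfWord` by explicit indices. -/
theorem halfWord_eq {t : ℕ → H} {i j l k : ℕ} (hj : k + 1 = j) (hl : i + l = k) :
    halfWord t i j = word t i l * t k * (word t i l)⁻¹ := by
  subst hl hj
  simp [halfWord]

variable {t : ℕ → H} {m : ℕ}

/-- `t (i - 1)` moves the left end of a half twist to the left. -/
theorem mul_halfWord_left {i j k : ℕ} (hk : k + 1 = i) (hij : i < j) :
    t k * halfWord t i j = halfWord t k j * t k := by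
  subst hk
  obtain ⟨l, rfl⟩ := Nat.exists_eq_add_of_lt hij
  rw [halfWord_eq (l := l) (k := k + 1 + l) (by omega) (by omega),
    halfWord_eq (i := k) (l := l + 1) (k := k + 1 + l) (by omega) (by omega), word_succ]
  group

/-- `t (j - 1)` moves the right end of a half twist to the left. -/
theorem BraidRelations.mul_halfWord_right (h : BraidRelations t m) {i j k : ℕ} (hj : j ≤ m)
    (hk : k + 1 = j) (hik : i < k) :
    t k * halfWord t i j = halfWord t i k * t k := by
  obtain ⟨l, rfl⟩ := Nat.exists_eq_add_of_lt hik
  have hc : Commute (t (i + l + 1)) (word t i l) :=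
    h.commute_word (by omega) (by omega) (by omega)
  rw [halfWord_eq (l := l + 1) (k := i + l + 1) (by omega) (by omega),
    halfWord_eq (l := l) (k := i + l) (by omega) (by omega), word_succ']
  have hb := h.braid (i + l) (by omega)
  -- The braid relation, read as an equality of two conjugates.
  have e : t (i + l) * t (i + l + 1) * (t (i + l))⁻¹ =
      (t (i + l + 1))⁻¹ * t (i + l) * t (i + l + 1) := by
    rw [mul_inv_eq_iff_eq_mul, mul_assoc, mul_assoc, eq_inv_mul_iff_mul_eq]
    simpa only [mul_assoc] using hb.symm
  calc _ = t (i + l + 1) * word t i l *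
        (t (i + l) * t (i + l + 1) * (t (i + l))⁻¹) * (word t i l)⁻¹ := by group
    _ = word t i l * t (i + l) * (t (i + l + 1) * (word t i l)⁻¹) := by
      rw [e, hc.eq]; group
    _ = _ := by rw [hc.inv_right.eq]; group

/-- The case that is not immediate has `k` strictly inside: by `mul_word`, conjugation by the word
of the half twist carries `t (k - 1)` to `t k`, and `t (k - 1)` commutes with the middle letter `t
(j - 1)`. -/
theorem BraidRelations.commute_halfWord (h : BraidRelations t m) {i j k : ℕ} (hj : j ≤ m)
    (hk : k < m) (hij : i < j)
    (hkij : k + 1 < i ∨ j < k ∨ (i < k ∧ k + 1 < j) ∨ (k = i ∧ j = i + 1)) :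
    Commute (t k) (halfWord t i j) := by
  obtain ⟨l, rfl⟩ := Nat.exists_eq_add_of_lt hij
  rw [halfWord_eq (l := l) (k := i + l) (by omega) (by omega)]
  rcases hkij with hk' | hk' | hk' | hk'
  · have := h.commute_word (k := k) (i := i) (l := l) hk (by omega) (by omega)
    exact (this.mul_right (h.comm' (by omega) hk (by omega))).mul_right this.inv_right
  · have := h.commute_word (k := k) (i := i) (l := l) hk (by omega) (by omega)
    exact (this.mul_right (h.comm' (by omega) hk (by omega))).mul_right this.inv_right
  · obtain ⟨k, rfl⟩ : ∃ k', k = k' + 1 := ⟨k - 1, by omega⟩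
    have e := h.mul_word (k := k) (i := i) (l := l) (by omega) (by omega) (by omega)
    have c := h.comm k (i + l) (by omega) (by omega)
    have e' : t (k + 1) = word t i l * t k * (word t i l)⁻¹ := by rw [← e]; group
    rw [e']
    exact (Commute.conj_iff (word t i l)).2 c
  · obtain ⟨rfl, hl⟩ := hk'
    obtain rfl : l = 0 := by omega
    simp

/-- Conjugation by `t k` or by its inverse carries the half twist of `i` and `j` to the half twist
of the images of `i` and `j` under the transposition of `k` and `k + 1`. -/
theorem BraidRelations.halfWord_swap (h : BraidRelations t m) {i j k : ℕ} (hj : j ≤ m)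
    (hk : k < m) (hij : i < j) (hne : ¬ (i = k ∧ j = k + 1)) :
    t k * halfWord t i j =
        halfWord t (Equiv.swap k (k + 1) i) (Equiv.swap k (k + 1) j) * t k ∨
      halfWord t i j * t k =
        t k * halfWord t (Equiv.swap k (k + 1) i) (Equiv.swap k (k + 1) j) := by
  have triv : ∀ a, a ≠ k → a ≠ k + 1 → Equiv.swap k (k + 1) a = a := fun a h₁ h₂ =>
    Equiv.swap_apply_of_ne_of_ne h₁ h₂
  by_cases h₁ : k + 1 < i ∨ j < k ∨ (i < k ∧ k + 1 < j)
  · left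
    rw [triv i (by omega) (by omega), triv j (by omega) (by omega)]
    exact h.commute_halfWord hj hk hij (by tauto)
  by_cases h₂ : k + 1 = i
  · left
    rw [← h₂, Equiv.swap_apply_right, triv j (by omega) (by omega)]
    exact mul_halfWord_left rfl (by omega)
  by_cases h₃ : k = i
  · right
    rw [← h₃, Equiv.swap_apply_left, triv j (by omega) (by omega)]
    exact (mul_halfWord_left rfl (by omega)).symm
  by_cases h₄ : k + 1 = j
  · left
    rw [← h₄, Equiv.swap_apply_right, triv i (by omega) (by omega)]
    exact h.mul_halfWord_right (by omega) rfl (by omega)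
  · obtain rfl : k = j := by omega
    right
    rw [Equiv.swap_apply_left, triv i (by omega) (by omega)]
    exact (h.mul_halfWord_right (by omega) rfl hij).symm

/-- The Coxeter presentation of the symmetric group: a homomorphism to a symmetric group is
injective on the subgroup generated by involutions that satisfy the braid relations and are sent
to the transpositions of neighbours. -/
theorem BraidRelations.eq_one_of_map_eq_one {n : ℕ} (π : H →* Equiv.Perm (Fin n))
    (h : BraidRelations t m) (hsq : ∀ i < m, t i * t i = 1) (hmn : m < n)
    (hπ : ∀ i (hi : i < m), π (t i) = Equiv.swap ⟨i, by omega⟩ ⟨i + 1, by omega⟩)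
    {x : H} (hx : x ∈ Subgroup.closure (t '' Set.Iio m)) (hx1 : π x = 1) : x = 1 := by
  induction m generalizing x with
  | zero => simpa using hx
  | succ m ih =>
    have hfix : ∀ y ∈ Subgroup.closure (t '' Set.Iio m), π y ⟨m + 1, hmn⟩ = ⟨m + 1, hmn⟩ := by
      intro y hy
      have : Subgroup.closure (t '' Set.Iio m) ≤
          (MulAction.stabilizer (Equiv.Perm (Fin n)) (⟨m + 1, hmn⟩ : Fin n)).comap π := by
        rw [Subgroup.closure_le]
        rintro _ ⟨i, hi, rfl⟩
        rw [Set.mem_Iio] at hi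
        change π (t i) _ = _
        rw [hπ i (by omega), Equiv.swap_apply_of_ne_of_ne] <;> simp [Fin.ext_iff] <;> omega
      exact this hy
    have hword : ∀ l j (hjl : j + l = m + 1),
        π (word t j l) ⟨m + 1, hmn⟩ = ⟨j, by omega⟩ := by
      intro l
      induction l with
      | zero => intro j hj; simp at hj; simp [hj]
      | succ l ihl =>
        intro j hj
        rw [word_succ, map_mul, Equiv.Perm.mul_apply, ihl (j + 1) (by omega), hπ j (by omega),
          Equiv.swap_apply_right]
    -- The cosets of the smaller subgroup by the words `t j ⋯ t m` are permuted by left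
    -- multiplication: a generator extends the word, commutes past it, cancels its first letter, or
    -- moves through it with index lowered. As such a word sends the point `m + 1` to `j` and the
    -- smaller subgroup fixes that point, `π x = 1` forces the word to be empty.
    have hform : ∃ l j, ∃ y ∈ Subgroup.closure (t '' Set.Iio m), j + l = m + 1 ∧
        x = word t j l * y := by
      have hgen : ∀ i < m + 1, ∀ x, (∃ l j, ∃ y ∈ Subgroup.closure (t '' Set.Iio m),
          j + l = m + 1 ∧ x = word t j l * y) → ∃ l j, ∃ y ∈ Subgroup.closure (t '' Set.Iio m),
          j + l = m + 1 ∧ t i * x = word t j l * y := by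
        rintro k hk _ ⟨l, j, y, hy, hjl, rfl⟩
        have hmem : ∀ i < m, t i ∈ Subgroup.closure (t '' Set.Iio m) := fun i hi =>
          Subgroup.subset_closure ⟨i, hi, rfl⟩
        rcases lt_trichotomy k j with hkj | rfl | hkj
        · rcases (Nat.succ_le_of_lt hkj).eq_or_lt with rfl | hkj
          · exact ⟨l + 1, k, y, hy, by omega, by rw [word_succ, mul_assoc]⟩
          · refine ⟨l, j, t k * y, mul_mem (hmem k (by omega)) hy, hjl, ?_⟩
            rw [← mul_assoc, (h.commute_word hk (by omega) (by omega)).eq, mul_assoc]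
        · obtain ⟨l, rfl⟩ : ∃ l', l = l' + 1 := ⟨l - 1, by omega⟩
          refine ⟨l, k + 1, y, hy, by omega, ?_⟩
          rw [word_succ, mul_assoc, ← mul_assoc (t k), hsq k hk, one_mul]
        · obtain ⟨k, rfl⟩ : ∃ k', k = k' + 1 := ⟨k - 1, by omega⟩
          refine ⟨l, j, t k * y, mul_mem (hmem k (by omega)) hy, hjl, ?_⟩
          rw [← mul_assoc, h.mul_word (by omega) (by omega) (by omega), mul_assoc]
      clear hx1
      induction hx using Subgroup.closure_induction_left with
      | one => exact ⟨0, m + 1, 1, one_mem _, rfl, by simp⟩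
      | mul_left a ha b _ hb =>
        obtain ⟨i, hi, rfl⟩ := ha
        exact hgen i hi _ hb
      | inv_mul_cancel a ha b _ hb =>
        obtain ⟨i, hi, rfl⟩ := ha
        rw [inv_eq_of_mul_eq_one_left (hsq i hi)]
        exact hgen i hi _ hb
    obtain ⟨l, j, y, hy, hjl, rfl⟩ := hform
    have hj := congrArg (fun g : Equiv.Perm (Fin n) => g ⟨m + 1, hmn⟩) hx1
    simp only [map_mul, Equiv.Perm.mul_apply, hfix y hy, hword l j hjl, Equiv.Perm.one_apply,
      Fin.mk.injEq] at hj
    obtain rfl : l = 0 := by omega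
    rw [word_zero, one_mul] at hx1 ⊢
    exact ih (h.mono (Nat.le_succ m)) (fun i hi => hsq i (by omega)) (by omega)
      (fun i hi => hπ i (by omega)) hy hx1

end Words

/-! ### Generators of the braid group -/

section Braids

variable {n : ℕ}

theorem gen_of_lt {i : ℕ} (h : i < n - 1) : gen n i = PresentedGroup.of ⟨i, h⟩ := dif_pos h

theorem braidRelations_gen (n : ℕ) : BraidRelations (gen n) (n - 1) where
  braid i hi := by
    rw [gen_of_lt hi, gen_of_lt (Nat.lt_of_succ_lt hi), ← mul_inv_eq_one]
    exact PresentedGroup.one_of_mem (rels := braidRels n)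
      (Or.inl ⟨⟨i, Nat.lt_of_succ_lt hi⟩, ⟨i + 1, hi⟩, rfl, rfl⟩)
  comm i j hij hj := by
    have hi : i < n - 1 := by omega
    rw [gen_of_lt hi, gen_of_lt hj, commute_iff_eq, ← mul_inv_eq_one]
    exact PresentedGroup.one_of_mem (rels := braidRels n) (Or.inr ⟨⟨i, hi⟩, ⟨j, hj⟩, hij, rfl⟩)

theorem BraidRelations.map {H H' : Type*} [Group H] [Group H'] {t : ℕ → H} {m : ℕ}
    (h : BraidRelations t m) (f : H →* H') : BraidRelations (fun i => f (t i)) m where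
  braid i hi := by simp only [← map_mul, h.braid i hi]
  comm i j hij hj := (h.comm i j hij hj).map f

theorem closure_gen (n : ℕ) : Subgroup.closure (gen n '' Set.Iio (n - 1)) = ⊤ := by
  rw [← top_le_iff, ← PresentedGroup.closure_range_of (braidRels n)]
  apply Subgroup.closure_mono
  rintro _ ⟨i, rfl⟩
  exact ⟨i, i.2, gen_of_lt i.2⟩

theorem braidPerm_gen {i : ℕ} (h : i < n - 1) :
    braidPerm n (gen n i) = Equiv.swap ⟨i, by omega⟩ ⟨i + 1, by omega⟩ := by
  rw [gen_of_lt h]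
  exact PresentedGroup.toGroup.of _

theorem braidPerm_gen_apply_val {k : ℕ} (hk : k < n - 1) (i : Fin n) :
    (braidPerm n (gen n k) i : ℕ) = Equiv.swap k (k + 1) (i : ℕ) := by
  rw [braidPerm_gen hk, Equiv.swap_apply_def, Equiv.swap_apply_def]
  simp only [Fin.ext_iff]
  split_ifs <;> rfl

theorem braidPerm_surjective (n : ℕ) : Function.Surjective (braidPerm n) := by
  rcases n with _ | n
  · exact fun g => ⟨1, Subsingleton.elim _ _⟩
  intro g
  have hg : g ∈ Submonoid.closure (Set.range fun i : Fin n => Equiv.swap i.castSucc i.succ) := by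
    rw [Equiv.Perm.mclosure_swap_castSucc_succ]
    trivial
  refine (Submonoid.closure_le (S := MonoidHom.mrange (braidPerm (n + 1)))).2 ?_ hg
  rintro _ ⟨i, rfl⟩
  exact ⟨gen (n + 1) i, braidPerm_gen (by simp)⟩

theorem braidPerm_word {l i j : ℕ} (hj : i + l = j) (hjn : j < n) :
    braidPerm n (word (gen n) i l) ⟨j, hjn⟩ = ⟨i, by omega⟩ := by
  induction l generalizing i with
  | zero => simp at hj; simp [hj]
  | succ l ih =>
    rw [word_succ, map_mul, Equiv.Perm.mul_apply, ih (by omega), braidPerm_gen (by omega),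
      Equiv.swap_apply_right]

theorem braidPerm_word_of_lt {l i j : ℕ} (hj : i + l < j) (hjn : j < n) :
    braidPerm n (word (gen n) i l) ⟨j, hjn⟩ = ⟨j, hjn⟩ := by
  induction l generalizing i with
  | zero => simp
  | succ l ih =>
    rw [word_succ, map_mul, Equiv.Perm.mul_apply, ih (by omega), braidPerm_gen (by omega),
      Equiv.swap_apply_of_ne_of_ne] <;> simp [Fin.ext_iff] <;> omega

theorem halfTwist_eq (i j : Fin n) : halfTwist n i j = halfWord (gen n) i j := rfl

/-- The full twist of the two strands of an unordered pair. -/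
def fullTwist (p : UPair n) : Braid n :=
  Sym2.lift ⟨fun i j => halfTwist n (min i j) (max i j) ^ 2, fun i j => by
    simp only [min_comm, max_comm]⟩ p.1

theorem fullTwist_mkPair {i j : Fin n} (h : i < j) :
    fullTwist (mkPair h) = halfTwist n i j ^ 2 := by
  simp [fullTwist, mkPair, h.le]

theorem UPair.exists_eq_mkPair (p : UPair n) :
    ∃ (i j : Fin n) (h : i < j), p = mkPair h := by
  obtain ⟨p, hp⟩ := p
  induction p with
  | _ i j =>
    rw [Sym2.mk_isDiag_iff] at hp
    rcases lt_or_gt_of_ne hp with h | h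
    · exact ⟨i, j, h, rfl⟩
    · exact ⟨j, i, h, Subtype.ext Sym2.eq_swap⟩

theorem UPair.smul_val (g : Equiv.Perm (Fin n)) (p : UPair n) : (g • p).1 = p.1.map g := rfl

theorem smul_mkPair_of_lt (g : Equiv.Perm (Fin n)) {i j : Fin n} (h : i < j) (hg : g i < g j) :
    g • mkPair h = mkPair hg := Subtype.ext rfl

theorem smul_mkPair_of_gt (g : Equiv.Perm (Fin n)) {i j : Fin n} (h : i < j) (hg : g j < g i) :
    g • mkPair h = mkPair hg := Subtype.ext Sym2.eq_swap

/-- The pair of neighbouring points. -/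
def adjPair {k : ℕ} (hk : k < n - 1) : UPair n :=
  mkPair (i := ⟨k, by omega⟩) (j := ⟨k + 1, by omega⟩) (Nat.lt_succ_self k)

theorem fullTwist_adjPair {k : ℕ} (hk : k < n - 1) : fullTwist (adjPair hk) = gen n k ^ 2 := by
  rw [adjPair, fullTwist_mkPair, halfTwist_eq, halfWord_self_succ]

theorem gen_smul_adjPair {k : ℕ} (hk : k < n - 1) :
    braidPerm n (gen n k) • adjPair hk = adjPair hk := by
  refine (smul_mkPair_of_gt _ _ ?_).trans ?_
  · rw [braidPerm_gen hk]; simp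
  · refine Subtype.ext ?_
    simp [mkPair, adjPair, braidPerm_gen hk]

/-- Every full twist is conjugate to the square of a generator. -/
theorem exists_fullTwist_eq (p : UPair n) : ∃ (k : ℕ) (hk : k < n - 1) (w : Braid n),
    fullTwist p = w * gen n k ^ 2 * w⁻¹ ∧ braidPerm n w • adjPair hk = p := by
  obtain ⟨i, j, hij, rfl⟩ := p.exists_eq_mkPair
  have hij' : (i : ℕ) < j := hij
  have hj := j.2
  refine ⟨j - 1, by omega, word (gen n) i (j - 1 - i), ?_, ?_⟩
  · rw [fullTwist_mkPair, halfTwist_eq, halfWord, conj_pow]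
  · have h₁ : braidPerm n (word (gen n) i (j - 1 - i)) ⟨j - 1, by omega⟩ = i :=
      braidPerm_word (by omega) _
    have h₂ : braidPerm n (word (gen n) i (j - 1 - i)) ⟨j - 1 + 1, by omega⟩ = j := by
      rw [braidPerm_word_of_lt (by omega)]
      exact Fin.ext (by simp; omega)
    refine Subtype.ext ?_
    simp [UPair.smul_val, adjPair, mkPair, h₁, h₂]

theorem gen_sq_mem {k : ℕ} (hk : k < n - 1) : gen n k ^ 2 ∈ PureBraid n := by
  rw [MonoidHom.mem_ker, map_pow, braidPerm_gen hk, pow_two, Equiv.swap_mul_self]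

theorem fullTwist_mem (p : UPair n) : fullTwist p ∈ PureBraid n := by
  obtain ⟨k, hk, w, hw, -⟩ := exists_fullTwist_eq p
  rw [hw]
  exact (inferInstance : (PureBraid n).Normal).conj_mem _ (gen_sq_mem hk) w

/-- The classes of pure braids commute in `G_n`. -/
theorem commute_mk {a b : Braid n} (ha : a ∈ PureBraid n) (hb : b ∈ PureBraid n) :
    Commute (QuotientGroup.mk a : BraidModComm n) (QuotientGroup.mk b) := by
  rw [commute_iff_eq, ← QuotientGroup.mk_mul, ← QuotientGroup.mk_mul, QuotientGroup.eq]
  have := Subgroup.commutator_mem_commutator (inv_mem hb) (inv_mem ha)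
  simpa [commutatorElement_def, mul_assoc] using this

/-- `halfWord_swap` describes conjugation by the generator only up to replacing it by its inverse.
The two conjugates of a full twist agree in `G_n`, because the square of the generator is pure and
pure braids commute there. -/
theorem mk_gen_conj_fullTwist {k : ℕ} (hk : k < n - 1) (p : UPair n) :
    (QuotientGroup.mk (gen n k * fullTwist p * (gen n k)⁻¹) : BraidModComm n) =
      QuotientGroup.mk (fullTwist (braidPerm n (gen n k) • p)) := by
  obtain ⟨i, j, hij, rfl⟩ := p.exists_eq_mkPair
  have hij' : (i : ℕ) < j := hij
  have hj := j.2
  by_cases hne : (i : ℕ) = k ∧ (j : ℕ) = k + 1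
  · have e : mkPair hij = adjPair hk := by
      refine Subtype.ext ?_
      simp only [mkPair, adjPair]
      congr 2 <;> exact Fin.ext (by simp [hne])
    rw [e, gen_smul_adjPair, fullTwist_adjPair]
    congr 1
    group
  -- The transposition of `k` and `k + 1` reverses the order of no other pair.
  have hlt : braidPerm n (gen n k) i < braidPerm n (gen n k) j := by
    rw [Fin.lt_def, braidPerm_gen_apply_val hk, braidPerm_gen_apply_val hk,
      Equiv.swap_apply_def, Equiv.swap_apply_def]
    split_ifs <;> omega
  rw [smul_mkPair_of_lt _ _ hlt, fullTwist_mkPair, fullTwist_mkPair, halfTwist_eq, halfTwist_eq,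
    braidPerm_gen_apply_val hk, braidPerm_gen_apply_val hk]
  have hmem := fullTwist_mem (mkPair hij)
  rw [fullTwist_mkPair, halfTwist_eq] at hmem
  rcases (braidRelations_gen n).halfWord_swap (i := i) (j := j) (by omega) hk hij' hne with e | e
  · rw [← conj_pow, e, mul_inv_cancel_right]
  · have e' := eq_inv_mul_of_mul_eq e.symm
    have hc : (QuotientGroup.mk (gen n k) : BraidModComm n) ^ 2 *
          QuotientGroup.mk (halfWord (gen n) i j ^ 2) =
        QuotientGroup.mk (halfWord (gen n) i j ^ 2) * (QuotientGroup.mk (gen n k)) ^ 2 :=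
      (commute_mk (gen_sq_mem hk) hmem).eq
    rw [e', ← mul_assoc, show ∀ a b : Braid n, (a⁻¹ * b * a) ^ 2 = a⁻¹ * b ^ 2 * a from
      fun a b => by simpa using conj_pow (a := a⁻¹) (b := b) (i := 2)]
    have : ∀ a b : BraidModComm n, a ^ 2 * b = b * a ^ 2 → a * b * a⁻¹ = a⁻¹ * b * a := by
      intro a b h
      rw [mul_inv_eq_iff_eq_mul, mul_assoc, mul_assoc, eq_inv_mul_iff_mul_eq, ← mul_assoc,
        ← pow_two, h, pow_two]
    exact this _ _ hc

/-- Conjugation permutes the classes of the full twists in `G_n`. -/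
theorem mk_conj_fullTwist (g : Braid n) (p : UPair n) :
    (QuotientGroup.mk (g * fullTwist p * g⁻¹) : BraidModComm n) =
      QuotientGroup.mk (fullTwist (braidPerm n g • p)) := by
  have hg : g ∈ Subgroup.closure (gen n '' Set.Iio (n - 1)) := closure_gen n ▸ Subgroup.mem_top g
  induction hg using Subgroup.closure_induction generalizing p with
  | mem x hx =>
    obtain ⟨k, hk, rfl⟩ := hx
    exact mk_gen_conj_fullTwist hk p
  | one => simp
  | mul x y _ _ hx hy =>
    have e : (QuotientGroup.mk (x * y * fullTwist p * (x * y)⁻¹) : BraidModComm n) =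
        QuotientGroup.mk x * QuotientGroup.mk (y * fullTwist p * y⁻¹) *
          (QuotientGroup.mk x)⁻¹ :=
      congrArg (QuotientGroup.mk (s := ⁅PureBraid n, PureBraid n⁆)) (by group)
    rw [e, hy, map_mul, mul_smul]
    exact hx _
  | inv x _ hx =>
    have e : (QuotientGroup.mk (x⁻¹ * fullTwist p * x⁻¹⁻¹) : BraidModComm n) =
        (QuotientGroup.mk x)⁻¹ * QuotientGroup.mk (fullTwist p) * QuotientGroup.mk x :=
      congrArg (QuotientGroup.mk (s := ⁅PureBraid n, PureBraid n⁆)) (by group)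
    have e' : (QuotientGroup.mk (fullTwist p) : BraidModComm n) = QuotientGroup.mk x *
        QuotientGroup.mk (fullTwist ((braidPerm n x)⁻¹ • p)) * (QuotientGroup.mk x)⁻¹ := by
      refine Eq.trans ?_ (hx ((braidPerm n x)⁻¹ • p)).symm
      rw [smul_inv_smul]
    rw [e, e', map_inv]
    group

end Braids

/-! ### Winding numbers -/

section Winding

variable {n : ℕ}

theorem pairRho_single (R : Type) [CommRing R] (g : Equiv.Perm (Fin n)) (p : UPair n) (r : R) :
    pairRho R n g (Finsupp.single p r) = Finsupp.single (g • p) r :=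
  Finsupp.mapDomain_single

theorem pairRho_apply_smul (R : Type) [CommRing R] (g : Equiv.Perm (Fin n)) (v : UPair n →₀ R)
    (p : UPair n) : pairRho R n g v (g • p) = v p :=
  Finsupp.mapDomain_apply (MulAction.injective g) v p

/-- The action of `S_n` on `ℤ^{C(n,2)}`, written multiplicatively. -/
def pairAut (n : ℕ) : Equiv.Perm (Fin n) →* MulAut (Multiplicative (UPair n →₀ ℤ)) where
  toFun g :=
    { toFun v := Multiplicative.ofAdd (pairRho ℤ n g v.toAdd)
      invFun v := Multiplicative.ofAdd (pairRho ℤ n g⁻¹ v.toAdd)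
      left_inv v := by simp
      right_inv v := by simp
      map_mul' v w := by simp }
  map_one' := by ext; simp
  map_mul' g h := by
    ext1 v
    simp [MulAut.mul_apply]

theorem pairAut_ofAdd (g : Equiv.Perm (Fin n)) (v : UPair n →₀ ℤ) :
    pairAut n g (Multiplicative.ofAdd v) = Multiplicative.ofAdd (pairRho ℤ n g v) := rfl

theorem pairAut_ofAdd_single (g : Equiv.Perm (Fin n)) (p : UPair n) (r : ℤ) :
    pairAut n g (Multiplicative.ofAdd (Finsupp.single p r)) =
      Multiplicative.ofAdd (Finsupp.single (g • p) r) := by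
  rw [pairAut_ofAdd, pairRho_single]

/-- The semidirect product `ℤ^{C(n,2)} ⋊ S_n`. -/
abbrev PairSemidirect (n : ℕ) : Type :=
  Multiplicative (UPair n →₀ ℤ) ⋊[pairAut n] Equiv.Perm (Fin n)

/-- The images of the generators in `ℤ^{C(n,2)} ⋊ S_n`. -/
def windingGen (n : ℕ) (i : Fin (n - 1)) : PairSemidirect n :=
  ⟨Multiplicative.ofAdd (Finsupp.single (adjPair i.2) 1), adjSwap n i⟩

/-- In the braid relation both sides count each of the three pairs among `i, i + 1, i + 2` once, in
different orders. In the far commutation relation each transposition fixes the other pair. -/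
theorem windingGen_rels (n : ℕ) : ∀ r ∈ braidRels n, FreeGroup.lift (windingGen n) r = 1 := by
  intro r hr
  have hright : (FreeGroup.lift (windingGen n) r).right = 1 := by
    rw [← adjSwap_rels n r hr]
    change ((SemidirectProduct.rightHom (φ := pairAut n)).comp (FreeGroup.lift (windingGen n))) r
      = _
    congr 1
    ext i
    simp [windingGen]
  rcases hr with ⟨i, j, hij, rfl⟩ | ⟨i, j, hij, rfl⟩
  · simp only [map_mul (FreeGroup.lift (windingGen n)), map_inv (FreeGroup.lift (windingGen n)),
      FreeGroup.lift_apply_of, mul_inv_eq_one] at hright ⊢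
    refine SemidirectProduct.ext ?_ ?_
    · obtain ⟨j, hj⟩ := j
      obtain ⟨i, hi⟩ := i
      simp only at hij
      subst hij
      have hne : i ≠ i + 1 + 1 := by omega
      have e₁ : adjSwap n ⟨i, hi⟩ • adjPair hj = adjSwap n ⟨i + 1, hj⟩ • adjPair hi := by
        refine Subtype.ext ?_
        simp [UPair.smul_val, adjPair, mkPair, adjSwap, Equiv.swap_apply_def, Fin.ext_iff, hne,
          hne.symm]
      have e₂ : (adjSwap n ⟨i, hi⟩ * adjSwap n ⟨i + 1, hj⟩) • adjPair hi = adjPair hj := by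
        refine Subtype.ext ?_
        simp [UPair.smul_val, adjPair, mkPair, adjSwap, Equiv.swap_apply_def, Fin.ext_iff, hne,
          hne.symm]
      have e₃ : (adjSwap n ⟨i + 1, hj⟩ * adjSwap n ⟨i, hi⟩) • adjPair hj = adjPair hi := by
        refine Subtype.ext ?_
        simp [UPair.smul_val, adjPair, mkPair, adjSwap, Equiv.swap_apply_def, Fin.ext_iff, hne,
          hne.symm]
      simp only [SemidirectProduct.mul_left, SemidirectProduct.mul_right, windingGen,
        pairAut_ofAdd_single, e₁, e₂, e₃]
      rw [mul_comm, mul_comm (Multiplicative.ofAdd (Finsupp.single (adjPair hi) (1 : ℤ))),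
        ← mul_assoc]
    · rwa [SemidirectProduct.mul_right, SemidirectProduct.inv_right, mul_inv_eq_one] at hright
  · simp only [map_mul (FreeGroup.lift (windingGen n)), map_inv (FreeGroup.lift (windingGen n)),
      FreeGroup.lift_apply_of, mul_inv_eq_one] at hright ⊢
    refine SemidirectProduct.ext ?_ ?_
    · have e₁ : adjSwap n i • adjPair j.2 = adjPair j.2 := by
        refine Subtype.ext ?_
        simp only [UPair.smul_val, adjPair, mkPair, adjSwap, Sym2.map_mk]
        rw [Equiv.swap_apply_of_ne_of_ne, Equiv.swap_apply_of_ne_of_ne] <;>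
          simp [Fin.ext_iff] <;> omega
      have e₂ : adjSwap n j • adjPair i.2 = adjPair i.2 := by
        refine Subtype.ext ?_
        simp only [UPair.smul_val, adjPair, mkPair, adjSwap, Sym2.map_mk]
        rw [Equiv.swap_apply_of_ne_of_ne, Equiv.swap_apply_of_ne_of_ne] <;>
          simp [Fin.ext_iff] <;> omega
      simp only [SemidirectProduct.mul_left, windingGen, pairAut_ofAdd_single, e₁, e₂]
      rw [mul_comm]
    · rwa [SemidirectProduct.mul_right, SemidirectProduct.inv_right, mul_inv_eq_one] at hright

/-- The homomorphism `B_n → ℤ^{C(n,2)} ⋊ S_n` that counts, for every pair of strands, their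
crossings with sign. -/
def winding (n : ℕ) : Braid n →* PairSemidirect n := PresentedGroup.toGroup (windingGen_rels n)

theorem winding_right (b : Braid n) : (winding n b).right = braidPerm n b := by
  change ((SemidirectProduct.rightHom (φ := pairAut n)).comp (winding n)) b = _
  congr 1
  refine PresentedGroup.ext fun i => ?_
  simp only [MonoidHom.comp_apply, winding, braidPerm, PresentedGroup.toGroup.of]
  rfl

/-- The transposition fixes its own pair, so both crossings count at the same basis element. -/
theorem winding_gen_sq {k : ℕ} (hk : k < n - 1) : winding n (gen n k ^ 2) =
    SemidirectProduct.inl (Multiplicative.ofAdd (Finsupp.single (adjPair hk) 2)) := by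
  refine SemidirectProduct.ext ?_ ?_
  · have h : winding n (gen n k) = windingGen n ⟨k, hk⟩ := by
      rw [gen_of_lt hk]
      exact PresentedGroup.toGroup.of _
    have e : adjSwap n ⟨k, hk⟩ • adjPair hk = adjPair hk := by
      have := gen_smul_adjPair hk
      rwa [braidPerm_gen hk] at this
    rw [map_pow, h, pow_two]
    simp only [SemidirectProduct.mul_left, windingGen, pairAut_ofAdd_single, e, ← ofAdd_add,
      ← Finsupp.single_add]
    rfl
  · rw [winding_right]
    exact gen_sq_mem hk

/-- A full twist is a conjugate of some `gen n k ^ 2`; the module part of the conjugator commutes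
with the image of this square, so only its permutation acts. -/
theorem winding_fullTwist (p : UPair n) : winding n (fullTwist p) =
    SemidirectProduct.inl (Multiplicative.ofAdd (Finsupp.single p 2)) := by
  obtain ⟨k, hk, w, hw, hp⟩ := exists_fullTwist_eq p
  have e : winding n w = SemidirectProduct.inl (winding n w).left *
      SemidirectProduct.inr (braidPerm n w) := by
    rw [← winding_right, SemidirectProduct.inl_left_mul_inr_right]
  rw [hw, map_mul, map_mul, winding_gen_sq hk, map_inv, e, mul_inv_rev, ← map_inv
    SemidirectProduct.inr]
  simp only [← mul_assoc]
  rw [mul_assoc (SemidirectProduct.inl _), mul_assoc (SemidirectProduct.inl _),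
    ← SemidirectProduct.inl_aut, pairAut_ofAdd_single, hp, ← map_mul, mul_comm, ← map_inv,
    ← map_mul, mul_inv_cancel_right]

end Winding

/-! ### The extension `G_n` -/

section Integral

variable {n : ℕ}

theorem commutator_le_ker_braidPerm (n : ℕ) :
    ⁅PureBraid n, PureBraid n⁆ ≤ (braidPerm n).ker := Subgroup.commutator_le_left _ _

theorem winding_eq_inl {b : Braid n} (hb : b ∈ PureBraid n) :
    winding n b = SemidirectProduct.inl (winding n b).left := by
  refine SemidirectProduct.ext rfl ?_
  rw [winding_right]
  exact hb

/-- Pure braids land in the abelian factor `ℤ^{C(n,2)}`. -/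
theorem commutator_le_ker_winding (n : ℕ) :
    ⁅PureBraid n, PureBraid n⁆ ≤ (winding n).ker := by
  rw [Subgroup.commutator_le]
  intro a ha b hb
  rw [MonoidHom.mem_ker, map_commutatorElement, commutatorElement_eq_one_iff_mul_comm,
    winding_eq_inl ha, winding_eq_inl hb, ← map_mul, ← map_mul, mul_comm]

/-- The map `G_n → S_n`. -/
def permOfModComm (n : ℕ) : BraidModComm n →* Equiv.Perm (Fin n) :=
  QuotientGroup.lift _ (braidPerm n) (commutator_le_ker_braidPerm n)

/-- The map `G_n → ℤ^{C(n,2)} ⋊ S_n`. -/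
def windingOfModComm (n : ℕ) : BraidModComm n →* PairSemidirect n :=
  QuotientGroup.lift _ (winding n) (commutator_le_ker_winding n)

theorem windingOfModComm_right (x : BraidModComm n) :
    (windingOfModComm n x).right = permOfModComm n x := by
  obtain ⟨b, rfl⟩ := QuotientGroup.mk_surjective x
  exact winding_right b

/-- The inclusion of `PB_n / [PB_n, PB_n]` in `G_n`. -/
def abelianizationToModComm (n : ℕ) : Abelianization (PureBraid n) →* BraidModComm n :=
  QuotientGroup.lift (commutator (PureBraid n))
    ((QuotientGroup.mk' ⁅PureBraid n, PureBraid n⁆).comp (PureBraid n).subtype) (by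
      rw [commutator_def, Subgroup.commutator_le]
      intro a _ b _
      rw [MonoidHom.mem_ker, MonoidHom.comp_apply, QuotientGroup.mk'_apply,
        QuotientGroup.eq_one_iff]
      exact Subgroup.commutator_mem_commutator a.2 b.2)

theorem abelianizationToModComm_injective (n : ℕ) :
    Function.Injective (abelianizationToModComm n) := by
  rw [injective_iff_map_eq_one]
  intro a ha
  obtain ⟨x, rfl⟩ := QuotientGroup.mk_surjective a
  change (QuotientGroup.mk (x : Braid n) : BraidModComm n) = 1 at ha
  rw [QuotientGroup.eq_one_iff] at ha
  refine (QuotientGroup.eq_one_iff x).2 ?_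
  rw [commutator_def]
  -- The commutator subgroup of `PB_n` as a group in its own right is carried onto the one formed
  -- inside `B_n`.
  have := Subgroup.map_commutator (⊤ : Subgroup (PureBraid n)) ⊤ (PureBraid n).subtype
  rw [← MonoidHom.range_eq_map, Subgroup.range_subtype] at this
  rw [← this] at ha
  obtain ⟨y, hy, hyx⟩ := ha
  rwa [← Subtype.ext hyx]

/-- The map `ℤ^{C(n,2)} → H₁(PB_n)` that sends a pair to the class of its full twist. -/
def twistHom (n : ℕ) : (UPair n →₀ ℤ) →+ Additive (Abelianization (PureBraid n)) :=
  Finsupp.liftAddHom fun p =>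
    zmultiplesHom _ (Additive.ofMul (Abelianization.of ⟨fullTwist p, fullTwist_mem p⟩))

theorem twistHom_single (p : UPair n) : twistHom n (Finsupp.single p 1) =
    Additive.ofMul (Abelianization.of ⟨fullTwist p, fullTwist_mem p⟩) := by
  simp [twistHom]

/-- The map `ℤ^{C(n,2)} → G_n` that sends a pair to the class of its full twist. -/
def twistInl (n : ℕ) : Multiplicative (UPair n →₀ ℤ) →* BraidModComm n :=
  (abelianizationToModComm n).comp (AddMonoidHom.toMultiplicativeLeft (twistHom n))

theorem twistInl_ofAdd (v : UPair n →₀ ℤ) : twistInl n (Multiplicative.ofAdd v) =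
    abelianizationToModComm n (twistHom n v).toMul := rfl

theorem twistInl_single (p : UPair n) :
    twistInl n (Multiplicative.ofAdd (Finsupp.single p 1)) = QuotientGroup.mk (fullTwist p) := by
  rw [twistInl_ofAdd, twistHom_single]
  rfl

/-- Homomorphisms out of `ℤ^{C(n,2)}` are determined by the images of the basis elements. -/
theorem pair_hom_ext {H : Type*} [Group H] {f g : Multiplicative (UPair n →₀ ℤ) →* H}
    (h : ∀ p, f (Multiplicative.ofAdd (Finsupp.single p 1)) =
      g (Multiplicative.ofAdd (Finsupp.single p 1))) : f = g := by
  refine Finsupp.mulHom_ext fun p r => ?_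
  have : (Finsupp.single p r : UPair n →₀ ℤ) = r • Finsupp.single p 1 := by simp
  rw [this, ofAdd_zsmul, map_zpow, map_zpow, h]

/-- Used twice: for the injectivity of `twistInl`, and for the vanishing of twice the class. -/
theorem windingOfModComm_twistInl (v : UPair n →₀ ℤ) :
    windingOfModComm n (twistInl n (Multiplicative.ofAdd v)) =
      SemidirectProduct.inl (Multiplicative.ofAdd ((2 : ℤ) • v)) := by
  have : (windingOfModComm n).comp (twistInl n) =
      SemidirectProduct.inl.comp (zpowGroupHom 2) := by
    refine pair_hom_ext fun p => ?_
    rw [MonoidHom.comp_apply, twistInl_single]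
    refine (winding_fullTwist p).trans ?_
    rw [MonoidHom.comp_apply, zpowGroupHom_apply, ← ofAdd_zsmul]
    simp
  exact DFunLike.congr_fun this (Multiplicative.ofAdd v)

theorem twistInl_injective (n : ℕ) : Function.Injective (twistInl n) := by
  intro v w h
  have := congrArg (windingOfModComm n) h
  rw [← ofAdd_toAdd v, ← ofAdd_toAdd w, windingOfModComm_twistInl, windingOfModComm_twistInl,
    SemidirectProduct.inl_inj, EmbeddingLike.apply_eq_iff_eq] at this
  exact Multiplicative.toAdd.injective (smul_right_injective _ two_ne_zero this)

theorem mul_twistInl_mul_inv (x : BraidModComm n) (v : UPair n →₀ ℤ) :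
    x * twistInl n (Multiplicative.ofAdd v) * x⁻¹ =
      twistInl n (Multiplicative.ofAdd (pairRho ℤ n (permOfModComm n x) v)) := by
  obtain ⟨b, rfl⟩ := QuotientGroup.mk_surjective x
  have : (MulAut.conj (QuotientGroup.mk b : BraidModComm n)).toMonoidHom.comp (twistInl n) =
      (twistInl n).comp (pairAut n (braidPerm n b)).toMonoidHom := by
    refine pair_hom_ext fun p => ?_
    simp only [MonoidHom.comp_apply, twistInl_single, MulEquiv.toMonoidHom_eq_coe,
      MonoidHom.coe_coe, pairAut_ofAdd_single]
    exact mk_conj_fullTwist b p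
  exact DFunLike.congr_fun this (Multiplicative.ofAdd v)

instance (n : ℕ) : (twistInl n).range.Normal := by
  constructor
  rintro _ ⟨v, rfl⟩ x
  exact ⟨_, (mul_twistInl_mul_inv x v.toAdd).symm⟩

theorem range_twistInl_le (n : ℕ) : (twistInl n).range ≤ (permOfModComm n).ker := by
  rintro _ ⟨v, rfl⟩
  rw [MonoidHom.mem_ker, ← windingOfModComm_right, ← ofAdd_toAdd v, windingOfModComm_twistInl,
    SemidirectProduct.right_inl]

/-- Modulo the full twists the generators of `G_n` square to 1, so
`BraidRelations.eq_one_of_map_eq_one` applies to the quotient. -/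
theorem ker_permOfModComm_le (hn : 1 ≤ n) : (permOfModComm n).ker ≤ (twistInl n).range := by
  intro x hx
  let q : Braid n →* BraidModComm n ⧸ (twistInl n).range :=
    (QuotientGroup.mk' (twistInl n).range).comp (QuotientGroup.mk' ⁅PureBraid n, PureBraid n⁆)
  have hq : Function.Surjective q :=
    (QuotientGroup.mk'_surjective _).comp (QuotientGroup.mk'_surjective _)
  rw [← QuotientGroup.eq_one_iff]
  refine ((braidRelations_gen n).map q).eq_one_of_map_eq_one (n := n)
    (QuotientGroup.lift _ (permOfModComm n) (range_twistInl_le n)) ?_ (by omega) ?_ ?_ hx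
  · intro i hi
    rw [← map_mul, ← pow_two]
    change ((QuotientGroup.mk (gen n i ^ 2) : BraidModComm n) :
      BraidModComm n ⧸ (twistInl n).range) = 1
    rw [QuotientGroup.eq_one_iff, ← fullTwist_adjPair hi]
    exact ⟨_, twistInl_single _⟩
  · intro i hi
    exact braidPerm_gen hi
  · have : (fun i => q (gen n i)) '' Set.Iio (n - 1) = q '' (gen n '' Set.Iio (n - 1)) := by
      rw [Set.image_image]
    rw [this, ← MonoidHom.map_closure, closure_gen, ← MonoidHom.range_eq_map,
      MonoidHom.range_eq_top.2 hq]
    exact Subgroup.mem_top _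

theorem range_twistInl (hn : 1 ≤ n) : (twistInl n).range = (permOfModComm n).ker :=
  le_antisymm (range_twistInl_le n) (ker_permOfModComm_le hn)

theorem exists_twistInl_eq (hn : 1 ≤ n) {b : Braid n} (hb : b ∈ PureBraid n) :
    ∃ v : UPair n →₀ ℤ, twistInl n (Multiplicative.ofAdd v) = QuotientGroup.mk b :=
  ker_permOfModComm_le hn
    (show (QuotientGroup.mk b : BraidModComm n) ∈ (permOfModComm n).ker from hb)

theorem twistHom_bijective (hn : 1 ≤ n) : Function.Bijective (twistHom n) := by
  refine ⟨fun v w h => ?_, fun a => ?_⟩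
  · refine Multiplicative.ofAdd.injective (twistInl_injective n ?_)
    rw [twistInl_ofAdd, twistInl_ofAdd, h]
  · obtain ⟨x, hx⟩ := QuotientGroup.mk_surjective a.toMul
    obtain ⟨v, hv⟩ := exists_twistInl_eq hn x.2
    refine ⟨v, Additive.toMul.injective (abelianizationToModComm_injective n ?_)⟩
    rw [← hx]
    exact hv

/-- The extension `0 → ℤ^{C(n,2)} → G_n → S_n → 1`. -/
def integralExtension (hn : 1 ≤ n) :
    GroupExtension (Multiplicative (pairRep ℤ n)) (BraidModComm n) (Equiv.Perm (Fin n)) where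
  inl := twistInl n
  rightHom := permOfModComm n
  inl_injective := twistInl_injective n
  range_inl_eq_ker_rightHom := range_twistInl hn
  rightHom_surjective :=
    QuotientGroup.lift_surjective_of_surjective _ _ (braidPerm_surjective n) _

theorem isStandard_integralExtension (hn : 1 ≤ n) : IsStandard (integralExtension hn) :=
  ⟨fun _ => rfl, fun i j h => (twistInl_single _).trans (by rw [fullTwist_mkPair])⟩

theorem givesRise_integralExtension (hn : 1 ≤ n) :
    GivesRise (pairRep ℤ n) (integralExtension hn) :=
  fun x v => mul_twistInl_mul_inv x v

/-- The identification of `H₁(PB_n)` with `ℤ^{C(n,2)}`. -/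
def abelianizationEquiv (hn : 1 ≤ n) :
    Additive (Abelianization (PureBraid n)) ≃+ (UPair n →₀ ℤ) :=
  (AddEquiv.ofBijective (twistHom n) (twistHom_bijective hn)).symm

theorem twistInl_abelianizationEquiv (hn : 1 ≤ n) (x : PureBraid n) :
    twistInl n (Multiplicative.ofAdd
        (abelianizationEquiv hn (Additive.ofMul (Abelianization.of x)))) =
      QuotientGroup.mk (x : Braid n) := by
  rw [twistInl_ofAdd]
  have := (AddEquiv.ofBijective (twistHom n) (twistHom_bijective hn)).apply_symm_apply
    (Additive.ofMul (Abelianization.of x))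
  rw [AddEquiv.ofBijective_apply] at this
  rw [abelianizationEquiv, this]
  rfl

end Integral

/-! ### The mod 4 braid group -/

section ModTwo

variable {n : ℕ}

theorem commutator_le_pureSquares (n : ℕ) : ⁅PureBraid n, PureBraid n⁆ ≤ pureSquares n := by
  rw [Subgroup.commutator_le]
  intro a ha b hb
  -- The reason that a group of exponent 2 is abelian: a commutator is a product of three squares.
  have h : a * b * a⁻¹ * b⁻¹ = a ^ 2 * (a⁻¹ * b) ^ 2 * (b⁻¹) ^ 2 := by
    simp [pow_two, mul_assoc]
  have hsq : ∀ p ∈ PureBraid n, p ^ 2 ∈ pureSquares n := fun p hp =>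
    Subgroup.subset_closure ⟨p, hp, rfl⟩
  rw [commutatorElement_def, h]
  exact mul_mem (mul_mem (hsq _ ha) (hsq _ (mul_mem (inv_mem ha) hb))) (hsq _ (inv_mem hb))

theorem pureSquares_le_ker_braidPerm (n : ℕ) : pureSquares n ≤ (braidPerm n).ker := by
  rw [pureSquares, Subgroup.closure_le]
  rintro _ ⟨p, hp, rfl⟩
  exact pow_mem hp 2

/-- The map `Z_n → S_n`. -/
def permOfModFour (n : ℕ) : ModFourBraid n →* Equiv.Perm (Fin n) :=
  QuotientGroup.lift _ (braidPerm n) (pureSquares_le_ker_braidPerm n)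

/-- The quotient map `G_n → Z_n`. -/
def modCommToModFour (n : ℕ) : BraidModComm n →* ModFourBraid n :=
  QuotientGroup.map _ _ (MonoidHom.id _) (commutator_le_pureSquares n)

theorem modCommToModFour_mk (b : Braid n) :
    modCommToModFour n (QuotientGroup.mk b) = QuotientGroup.mk b := rfl

theorem modCommToModFour_surjective (n : ℕ) : Function.Surjective (modCommToModFour n) := by
  intro x
  obtain ⟨b, rfl⟩ := QuotientGroup.mk_surjective x
  exact ⟨QuotientGroup.mk b, rfl⟩

theorem permOfModFour_modCommToModFour (x : BraidModComm n) :
    permOfModFour n (modCommToModFour n x) = permOfModComm n x := by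
  obtain ⟨b, rfl⟩ := QuotientGroup.mk_surjective x
  rfl

/-- Coefficientwise reduction modulo 2. -/
def reduceHom (n : ℕ) : (UPair n →₀ ℤ) →+ (UPair n →₀ ZMod 2) :=
  Finsupp.mapRange.addMonoidHom (Int.castAddHom (ZMod 2))

theorem reduceHom_apply (v : UPair n →₀ ℤ) (p : UPair n) : reduceHom n v p = (v p : ZMod 2) := rfl

theorem reduceHom_surjective (n : ℕ) : Function.Surjective (reduceHom n) :=
  Finsupp.mapRange_surjective _ (map_zero _) ZMod.intCast_surjective

theorem reduceHom_eq_zero_iff (v : UPair n →₀ ℤ) :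
    reduceHom n v = 0 ↔ ∃ w : UPair n →₀ ℤ, v = (2 : ℤ) • w := by
  constructor
  · intro h
    refine ⟨v.mapRange (· / 2) rfl, Finsupp.ext fun p => ?_⟩
    have hp := DFunLike.congr_fun h p
    rw [reduceHom_apply, Finsupp.zero_apply, ZMod.intCast_zmod_eq_zero_iff_dvd] at hp
    simp only [Finsupp.smul_apply, Finsupp.mapRange_apply, smul_eq_mul]
    push_cast at hp
    omega
  · rintro ⟨w, rfl⟩
    ext p
    have h : ((2 : ℤ) : ZMod 2) = 0 := rfl
    rw [reduceHom_apply, Finsupp.smul_apply, smul_eq_mul, Int.cast_mul, h, zero_mul,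
      Finsupp.zero_apply]

theorem pairRho_reduceHom (g : Equiv.Perm (Fin n)) (v : UPair n →₀ ℤ) :
    pairRho (ZMod 2) n g (reduceHom n v) = reduceHom n (pairRho ℤ n g v) :=
  Finsupp.mapDomain_mapRange (g • ·) v (Int.castAddHom (ZMod 2)) (map_zero _) (map_add _)

/-- In the abelian image of `PB_n` a product of squares is again a square. -/
theorem exists_mk_eq_of_mem_pureSquares (hn : 1 ≤ n) {b : Braid n} (hb : b ∈ pureSquares n) :
    ∃ v : UPair n →₀ ℤ,
      (QuotientGroup.mk b : BraidModComm n) = twistInl n (Multiplicative.ofAdd ((2 : ℤ) • v)) := by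
  induction hb using Subgroup.closure_induction with
  | mem x hx =>
    obtain ⟨p, hp, rfl⟩ := hx
    obtain ⟨v, hv⟩ := exists_twistInl_eq hn hp
    refine ⟨v, ?_⟩
    rw [ofAdd_zsmul, map_zpow, hv]
    rfl
  | one => exact ⟨0, by simp⟩
  | mul x y _ _ hx hy =>
    obtain ⟨v, hv⟩ := hx
    obtain ⟨w, hw⟩ := hy
    refine ⟨v + w, ?_⟩
    rw [smul_add, ofAdd_add, map_mul, ← hv, ← hw]
    rfl
  | inv x _ hx =>
    obtain ⟨v, hv⟩ := hx
    refine ⟨-v, ?_⟩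
    rw [smul_neg, ofAdd_neg, map_inv, ← hv]
    rfl

/-- This makes the map from `(ℤ/2)^{C(n,2)}` to `Z_n` both well defined and injective. -/
theorem modCommToModFour_twistInl_eq_one_iff (hn : 1 ≤ n) (v : UPair n →₀ ℤ) :
    modCommToModFour n (twistInl n (Multiplicative.ofAdd v)) = 1 ↔ reduceHom n v = 0 := by
  rw [reduceHom_eq_zero_iff]
  constructor
  · intro h
    obtain ⟨b, hb⟩ := QuotientGroup.mk_surjective (twistInl n (Multiplicative.ofAdd v))
    rw [← hb, modCommToModFour_mk, QuotientGroup.eq_one_iff] at h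
    obtain ⟨w, hw⟩ := exists_mk_eq_of_mem_pureSquares hn h
    exact ⟨w, Multiplicative.ofAdd.injective (twistInl_injective n (hb.symm.trans hw))⟩
  · rintro ⟨w, rfl⟩
    obtain ⟨b, hb⟩ := QuotientGroup.mk_surjective (twistInl n (Multiplicative.ofAdd w))
    have hmem : b ∈ PureBraid n := by
      have := range_twistInl_le n ⟨_, rfl⟩ (x := twistInl n (Multiplicative.ofAdd w))
      rwa [← hb] at this
    rw [ofAdd_zsmul, map_zpow, ← hb, map_zpow, modCommToModFour_mk]
    refine (QuotientGroup.eq_one_iff (b ^ (2 : ℤ))).2 ?_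
    exact Subgroup.subset_closure ⟨b, hmem, by norm_cast⟩

/-- The map `(ℤ/2)^{C(n,2)} → Z_n` that sends a pair to the class of its full twist. -/
def twistInlModTwo (hn : 1 ≤ n) : Multiplicative (UPair n →₀ ZMod 2) →* ModFourBraid n :=
  (AddMonoidHom.toMultiplicative (reduceHom n)).liftOfSurjective (reduceHom_surjective n)
    ⟨(modCommToModFour n).comp (twistInl n), fun v hv =>
      (modCommToModFour_twistInl_eq_one_iff hn v.toAdd).2 hv⟩

theorem twistInlModTwo_reduceHom (hn : 1 ≤ n) (v : UPair n →₀ ℤ) :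
    twistInlModTwo hn (Multiplicative.ofAdd (reduceHom n v)) =
      modCommToModFour n (twistInl n (Multiplicative.ofAdd v)) :=
  MonoidHom.liftOfRightInverse_comp_apply (AddMonoidHom.toMultiplicative (reduceHom n)) _ _ _
    (Multiplicative.ofAdd v)

theorem twistInlModTwo_injective (hn : 1 ≤ n) : Function.Injective (twistInlModTwo hn) := by
  rw [injective_iff_map_eq_one]
  intro a ha
  obtain ⟨v, hv⟩ := reduceHom_surjective n a.toAdd
  rw [← ofAdd_toAdd a, ← hv, twistInlModTwo_reduceHom,
    modCommToModFour_twistInl_eq_one_iff] at ha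
  · exact hv.symm.trans ha
  · exact hn

theorem range_twistInlModTwo (hn : 1 ≤ n) :
    (twistInlModTwo hn).range = (permOfModFour n).ker := by
  refine le_antisymm ?_ fun x hx => ?_
  · rintro _ ⟨a, rfl⟩
    obtain ⟨v, hv⟩ := reduceHom_surjective n a.toAdd
    rw [MonoidHom.mem_ker, ← ofAdd_toAdd a, ← hv, twistInlModTwo_reduceHom,
      permOfModFour_modCommToModFour]
    exact range_twistInl_le n ⟨_, rfl⟩
  · obtain ⟨b, rfl⟩ := QuotientGroup.mk_surjective x
    obtain ⟨v, hv⟩ := exists_twistInl_eq hn (b := b) hx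
    exact ⟨_, (twistInlModTwo_reduceHom hn v).trans (by rw [hv, modCommToModFour_mk])⟩

/-- The extension `0 → (ℤ/2)^{C(n,2)} → Z_n → S_n → 1`. -/
def modTwoExtension (hn : 1 ≤ n) :
    GroupExtension (Multiplicative (pairRep (ZMod 2) n)) (ModFourBraid n)
      (Equiv.Perm (Fin n)) where
  inl := twistInlModTwo hn
  rightHom := permOfModFour n
  inl_injective := twistInlModTwo_injective hn
  range_inl_eq_ker_rightHom := range_twistInlModTwo hn
  rightHom_surjective :=
    QuotientGroup.lift_surjective_of_surjective _ _ (braidPerm_surjective n) _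

theorem isStandard_modTwoExtension (hn : 1 ≤ n) : IsStandard (modTwoExtension hn) := by
  refine ⟨fun _ => rfl, fun i j h => ?_⟩
  have e : (Finsupp.single (mkPair h) 1 : UPair n →₀ ZMod 2) =
      reduceHom n (Finsupp.single (mkPair h) 1) := by
    simp [reduceHom]
  rw [e]
  refine (twistInlModTwo_reduceHom hn _).trans ?_
  rw [twistInl_single, fullTwist_mkPair, modCommToModFour_mk]

theorem givesRise_modTwoExtension (hn : 1 ≤ n) :
    GivesRise (pairRep (ZMod 2) n) (modTwoExtension hn) := by
  intro x a
  obtain ⟨y, rfl⟩ := modCommToModFour_surjective n x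
  obtain ⟨v, rfl⟩ := reduceHom_surjective n a
  change _ * twistInlModTwo hn _ * _ = twistInlModTwo hn (Multiplicative.ofAdd
    (pairRho (ZMod 2) n (permOfModFour n (modCommToModFour n y)) (reduceHom n v)))
  rw [permOfModFour_modCommToModFour, pairRho_reduceHom, twistInlModTwo_reduceHom,
    twistInlModTwo_reduceHom, ← mul_twistInl_mul_inv, map_mul, map_mul, map_inv]

/-- The section of `Z_n → S_n` that is induced by a section of `G_n → S_n`. -/
def sectionModTwo (hn : 1 ≤ n) (s : (integralExtension hn).Section) :
    (modTwoExtension hn).Section where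
  toFun g := modCommToModFour n (s g)
  rightInverse_rightHom g :=
    (permOfModFour_modCommToModFour _).trans (s.rightInverse_rightHom g)

end ModTwo

/-! ### The order of the class of `G_n` -/

section Order

variable {n : ℕ}

theorem two_nsmul_H2π_eq_zero (hn : 1 ≤ n) (s : (integralExtension hn).Section)
    (f : cocycles₂ (pairRep ℤ n))
    (hf : ∀ p q, s p * s q =
      (integralExtension hn).inl (Multiplicative.ofAdd (f (p, q))) * s (p * q)) :
    2 • H2π (pairRep ℤ n) f = 0 := by
  rw [← map_nsmul, H2π_eq_zero_iff]
  -- The crossing numbers of the section form a cochain; applying `winding` to the factor set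
  -- equation says that its coboundary is `2f`.
  let h : Equiv.Perm (Fin n) → (UPair n →₀ ℤ) := fun g => (windingOfModComm n (s g)).left.toAdd
  refine ⟨h, funext fun ⟨p, q⟩ => ?_⟩
  have hs : ∀ g, (windingOfModComm n (s g)).right = g := fun g =>
    (windingOfModComm_right _).trans (s.rightInverse_rightHom g)
  have e := congrArg (fun x => (windingOfModComm n x).left.toAdd) (hf p q)
  simp only [map_mul, SemidirectProduct.mul_left] at e
  rw [hs] at e
  change h p + pairRho ℤ n p (h q) = (windingOfModComm n (twistInl n _)).left.toAdd +
    pairRho ℤ n (windingOfModComm n (twistInl n _)).right (h (p * q)) at e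
  rw [windingOfModComm_twistInl, SemidirectProduct.left_inl, SemidirectProduct.right_inl, map_one,
    toAdd_ofAdd] at e
  rw [d₁₂_hom_apply]
  change pairRho ℤ n p (h q) - h (p * q) + h p = (2 : ℕ) • (f (p, q) : UPair n →₀ ℤ)
  have e' : h p + pairRho ℤ n p (h q) = (2 : ℕ) • (f (p, q) : UPair n →₀ ℤ) + h (p * q) := by
    rw [e, ← natCast_zsmul]
    rfl
  rw [sub_add_eq_add_sub, add_comm, e', add_sub_cancel_right]

/-- A parity count for the lift `s σ` of one transposition `σ`, at the pair `P` that `σ` fixes. -/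
theorem H2π_ne_zero (hn : 1 ≤ n) (hn2 : 2 ≤ n) (s : (integralExtension hn).Section)
    (f : cocycles₂ (pairRep ℤ n))
    (hf : ∀ p q, s p * s q =
      (integralExtension hn).inl (Multiplicative.ofAdd (f (p, q))) * s (p * q)) :
    H2π (pairRep ℤ n) f ≠ 0 := by
  rw [Ne, H2π_eq_zero_iff]
  rintro ⟨h, hh⟩
  have hk : 0 < n - 1 := by omega
  set σ := braidPerm n (gen n 0) with hσ
  have hσσ : σ * σ = 1 := by rw [hσ, braidPerm_gen hk, Equiv.swap_mul_self]
  have hrise := givesRise_integralExtension hn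
  let P : UPair n := adjPair hk
  have hev : ∀ v : UPair n →₀ ℤ, pairRho ℤ n σ v P = v P := fun v => by
    have := pairRho_apply_smul ℤ σ v P
    rwa [gen_smul_adjPair hk] at this
  have hfh : ∀ p q, (f (p, q) : UPair n →₀ ℤ) =
      pairRho ℤ n p (h q) - h (p * q) + h p := fun p q => by
    have := congrFun hh (p, q)
    rw [d₁₂_hom_apply] at this
    exact this.symm
  obtain ⟨a, ha⟩ := exists_eq_inl_ofAdd_mul (S := integralExtension hn) (x := s σ)
    (y := QuotientGroup.mk (gen n 0)) (s.rightInverse_rightHom σ)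
  -- The section need not be normalised, so `s 1` contributes `f (1, 1)`.
  have h1 : s 1 = (integralExtension hn).inl (Multiplicative.ofAdd (f (1, 1))) := by
    have := hf 1 1
    rw [mul_one] at this
    exact mul_right_cancel this
  have h2 := hf σ σ
  have hsq : (QuotientGroup.mk (gen n 0) : BraidModComm n) * QuotientGroup.mk (gen n 0) =
      (integralExtension hn).inl (Multiplicative.ofAdd (Finsupp.single P 1)) := by
    refine Eq.trans ?_ (twistInl_single P).symm
    rw [fullTwist_adjPair, pow_two]
    rfl
  rw [hσσ, h1, ha, hrise.inl_mul_mul_inl_mul, hsq,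
    ← map_mul (integralExtension hn).inl, ← map_mul (integralExtension hn).inl, ← ofAdd_add,
    ← ofAdd_add] at h2
  have h3 : a + pairRho ℤ n σ a + Finsupp.single P 1 =
      (f (σ, σ) : UPair n →₀ ℤ) + f (1, 1) :=
    Multiplicative.ofAdd.injective ((integralExtension hn).inl_injective h2)
  rw [hfh, hfh, hσσ] at h3
  have h4 := DFunLike.congr_fun h3 P
  simp only [Finsupp.add_apply, Finsupp.sub_apply, hev, map_one, Module.End.one_apply, mul_one,
    Finsupp.single_eq_same] at h4
  -- At `P` the left side is `2 a P + 1`. On the right the terms in `h 1` cancel and `2 h σ P`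
  -- remains.
  omega

end Order

/-! ### Reduction modulo 2 of the class of `G_n` -/

section Reduction

variable {n : ℕ}

/-- Reduction modulo 2 of cocycles. -/
def reduceCocycle (f : cocycles₂ (pairRep ℤ n)) : cocycles₂ (pairRep (ZMod 2) n) :=
  mapCocycles₂ (MonoidHom.id _) (reduceModTwo n) f

theorem reduceCocycle_apply (f : cocycles₂ (pairRep ℤ n)) (p q : Equiv.Perm (Fin n)) :
    reduceCocycle f (p, q) = reduceHom n (f (p, q)) := rfl

theorem functor_map_H2π {G : Type} [Group G] {A B : Rep ℤ G} (φ : A ⟶ B) (f : cocycles₂ A) :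
    (groupCohomology.functor ℤ G 2).map φ (H2π A f) =
      H2π B (mapCocycles₂ (A := A) (MonoidHom.id _) φ f) :=
  H2π_comp_map_apply (MonoidHom.id _) φ f

theorem sectionModTwo_mul (hn : 1 ≤ n) (s : (integralExtension hn).Section)
    (f : cocycles₂ (pairRep ℤ n))
    (hf : ∀ p q, s p * s q =
      (integralExtension hn).inl (Multiplicative.ofAdd (f (p, q))) * s (p * q))
    (p q : Equiv.Perm (Fin n)) :
    sectionModTwo hn s p * sectionModTwo hn s q =
      (modTwoExtension hn).inl (Multiplicative.ofAdd (reduceCocycle f (p, q))) *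
        sectionModTwo hn s (p * q) := by
  have h := congrArg (modCommToModFour n) (hf p q)
  rw [map_mul, map_mul] at h
  refine h.trans ?_
  rw [reduceCocycle_apply]
  exact congrArg (· * modCommToModFour n (s (p * q)))
    (twistInlModTwo_reduceHom hn (f (p, q))).symm

end Reduction

end BraidExt

end

theorem theorem1p1 (n : ℕ) (hn : 1 ≤ n) :
    ∃ (S : GroupExtension (Multiplicative (BraidExt.pairRep ℤ n)) (BraidExt.BraidModComm n)
          (Equiv.Perm (Fin n)))
      (T : GroupExtension (Multiplicative (BraidExt.pairRep (ZMod 2) n)) (BraidExt.ModFourBraid n)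
          (Equiv.Perm (Fin n)))
      (φ : groupCohomology.H2 (BraidExt.pairRep ℤ n))
      (κ : groupCohomology.H2 (BraidExt.pairRep (ZMod 2) n)),
      BraidExt.IsStandard S ∧
      BraidExt.IsStandard T ∧
      -- `ℤ^{C(n,2)}` is `H₁(PB_n; ℤ)`, included in `G_n` by the natural map
      (∃ e : Additive (Abelianization (BraidExt.PureBraid n)) ≃+ (BraidExt.UPair n →₀ ℤ),
        ∀ x : BraidExt.PureBraid n,
          S.inl (Multiplicative.ofAdd (e (Additive.ofMul (Abelianization.of x)))) =
            QuotientGroup.mk (x : BraidExt.Braid n)) ∧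
      BraidExt.IsClassifiedBy (BraidExt.pairRep ℤ n) S φ ∧
      BraidExt.IsClassifiedBy (BraidExt.pairRep (ZMod 2) n) T κ ∧
      (groupCohomology.functor ℤ (Equiv.Perm (Fin n)) 2).map (BraidExt.reduceModTwo n) φ = κ ∧
      (2 ≤ n → addOrderOf φ = 2) := by
  -- One section of `G_n → S_n` serves both classes: its image in `Z_n` has the reduced factor set.
  obtain ⟨f, hf⟩ := (BraidExt.givesRise_integralExtension hn).exists_factorSet
    (BraidExt.integralExtension hn).surjInvRightHom
  exact ⟨BraidExt.integralExtension hn, BraidExt.modTwoExtension hn,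
    H2π _ f, H2π _ (BraidExt.reduceCocycle f),
    BraidExt.isStandard_integralExtension hn, BraidExt.isStandard_modTwoExtension hn,
    ⟨BraidExt.abelianizationEquiv hn, BraidExt.twistInl_abelianizationEquiv hn⟩,
    (BraidExt.givesRise_integralExtension hn).isClassifiedBy _ f hf,
    (BraidExt.givesRise_modTwoExtension hn).isClassifiedBy (BraidExt.sectionModTwo hn _) _
      (BraidExt.sectionModTwo_mul hn _ f hf),
    BraidExt.functor_map_H2π (BraidExt.reduceModTwo n) f, fun hn2 =>
    addOrderOf_eq_prime (BraidExt.two_nsmul_H2π_eq_zero hn _ f hf)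
      (BraidExt.H2π_ne_zero hn hn2 _ f hf)⟩
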